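/- Let $I=[0,1]$ and let $\mathrm{PL}_o(I)$ be the group, under composition, of all orientation-preserving piecewise-linear homeomorphisms of $I$ with finitely many breaks in slope. Let $\mathbb{Z}\wr(\mathbb{Z}\times\mathbb{Z})$ be the standard restricted wreath product, i.e. the semidirect product $\bigl(\bigoplus_{\mathbb{Z}\times\mathbb{Z}}\mathbb{Z}\bigr)\rtimes(\mathbb{Z}\times\mathbb{Z})$ in which $\mathbb{Z}\times\mathbb{Z}$ acts on the direct sum by translating the coordinates. Then $\mathbb{Z}\wr(\mathbb{Z}\times\mathbb{Z})$ does not embed in $\mathrm{PL}_o(I)$: there is no injective group homomorphism $\mathbb{Z}\wr(\mathbb{Z}\times\mathbb{Z})\to\mathrm{PL}_o(I)$. -/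

import Mathlib

/-- A self-map `f` of the unit interval `I = [0,1]` is piecewise linear with finitely many breaks:
there is a finite set `B` of points of `I` such that `f` agrees with an affine function
`z ↦ m * z + c` on every closed subinterval `[x, y]` of `I` whose interior contains no point
of `B`. -/
def IsPiecewiseLinear (f : unitInterval → unitInterval) : Prop :=
  ∃ B : Set unitInterval, B.Finite ∧
    ∀ x y : unitInterval, x < y → Disjoint (Set.Ioo x y) B →
      ∃ m c : ℝ, ∀ z ∈ Set.Icc x y, (f z : ℝ) = m * (z : ℝ) + c

theorem IsPiecewiseLinear.id : IsPiecewiseLinear (fun x => x) :=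
  ⟨∅, Set.finite_empty, fun _ _ _ _ => ⟨1, 0, fun z _ => by simp⟩⟩

theorem IsPiecewiseLinear.mul {f g : unitInterval ≃ₜ unitInterval} (hgm : StrictMono g)
    (hf : IsPiecewiseLinear f) (hg : IsPiecewiseLinear g) :
    IsPiecewiseLinear (f * g : unitInterval ≃ₜ unitInterval) := by
  obtain ⟨B, hB, hfB⟩ := hf
  obtain ⟨D, hD, hgD⟩ := hg
  refine ⟨D ∪ g ⁻¹' B, hD.union (hB.preimage g.injective.injOn), fun x y hxy hd => ?_⟩
  rw [Set.disjoint_union_right] at hd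
  obtain ⟨m, c, hmc⟩ := hgD x y hxy hd.1
  obtain ⟨m', c', hmc'⟩ := hfB (g x) (g y) (hgm hxy) (by
    rw [Set.disjoint_left]
    rintro w ⟨h1, h2⟩ hw
    obtain ⟨v, rfl⟩ := g.surjective w
    exact Set.disjoint_left.1 hd.2 ⟨hgm.lt_iff_lt.1 h1, hgm.lt_iff_lt.1 h2⟩ hw)
  refine ⟨m' * m, m' * c + c', fun z hz => ?_⟩
  have h := hmc' (g z) ⟨hgm.monotone hz.1, hgm.monotone hz.2⟩
  rw [hmc z hz] at h
  change ((f (g z) : unitInterval) : ℝ) = _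
  rw [h]
  ring

theorem StrictMono.homeomorph_inv {f : unitInterval ≃ₜ unitInterval} (hf : StrictMono f) :
    StrictMono (f⁻¹ : unitInterval ≃ₜ unitInterval) := by
  intro x y hxy
  obtain ⟨u, rfl⟩ := f.surjective x
  obtain ⟨v, rfl⟩ := f.surjective y
  change f.symm (f u) < f.symm (f v)
  simpa using hf.lt_iff_lt.1 hxy

theorem IsPiecewiseLinear.inv {f : unitInterval ≃ₜ unitInterval} (hfm : StrictMono f)
    (hf : IsPiecewiseLinear f) :
    IsPiecewiseLinear (f⁻¹ : unitInterval ≃ₜ unitInterval) := by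
  obtain ⟨B, hB, hfB⟩ := hf
  refine ⟨f '' B, hB.image f, fun x y hxy hd => ?_⟩
  obtain ⟨u, rfl⟩ := f.surjective x
  obtain ⟨v, rfl⟩ := f.surjective y
  have huv : u < v := hfm.lt_iff_lt.1 hxy
  obtain ⟨m, c, hmc⟩ := hfB u v huv (by
    rw [Set.disjoint_left]
    intro w hw hwB
    exact Set.disjoint_left.1 hd ⟨hfm hw.1, hfm hw.2⟩ ⟨w, hwB, rfl⟩)
  have hm : m ≠ 0 := by
    rintro rfl
    have h1 := hmc u ⟨le_rfl, huv.le⟩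
    have h2 := hmc v ⟨huv.le, le_rfl⟩
    exact hxy.ne (Subtype.ext (by rw [h1, h2]; ring))
  refine ⟨m⁻¹, -(m⁻¹ * c), fun z hz => ?_⟩
  obtain ⟨w, rfl⟩ := f.surjective z
  have h := hmc w ⟨hfm.le_iff_le.1 hz.1, hfm.le_iff_le.1 hz.2⟩
  change ((f.symm (f w) : unitInterval) : ℝ) = _
  rw [h, f.symm_apply_apply]
  field_simp
  ring

/-- `PLo(I)`: the group, under composition, of the orientation-preserving (that is, strictly
increasing) piecewise-linear homeomorphisms of the unit interval with finitely many breaks. -/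
def PLo : Subgroup (unitInterval ≃ₜ unitInterval) where
  carrier := {f | StrictMono f ∧ IsPiecewiseLinear f}
  one_mem' := ⟨strictMono_id, IsPiecewiseLinear.id⟩
  mul_mem' := fun {_ _} hf hg => ⟨hf.1.comp hg.1, IsPiecewiseLinear.mul hg.1 hf.2 hg.2⟩
  inv_mem' := fun {_} hf => ⟨hf.1.homeomorph_inv, IsPiecewiseLinear.inv hf.1 hf.2⟩

/-- The standard restricted wreath product of `C` by `T`: the subgroup of the (unrestricted)
regular wreath product `C ≀ᵣ T`, whose base group consists of all functions `T → C`, formed by the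
pairs `(b, t)` such that `b` is trivial at all but finitely many elements of `T`. -/
def RestrictedWreathProduct (C T : Type*) [Group C] [Group T] :
    Subgroup (RegularWreathProduct C T) where
  carrier := {a | (Function.mulSupport a.left).Finite}
  one_mem' := by simp
  mul_mem' := by
    intro a b ha hb
    have h : (Function.mulSupport fun x => b.left (a.right⁻¹ * x)).Finite :=
      hb.preimage (mul_right_injective a.right⁻¹).injOn
    exact (ha.union h).subset (Function.mulSupport_mul _ _)
  inv_mem' := by
    intro a ha
    have h : (Function.mulSupport fun x => a.left (a.right * x)).Finite :=
      ha.preimage (mul_right_injective a.right).injOn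
    refine h.subset fun x hx hx' => hx ?_
    simpa using hx'

/-!
Suppose `ℤ ≀ (ℤ × ℤ)` embeds in `PLo`. Then `PLo` contains a nontrivial abelian subgroup `A` (the
image of the base group) normalized by commuting maps `τ k`, `k : ℤ × ℤ`, such that
`a⁻¹ (τ k) a (τ k)⁻¹ ≠ 1` for all `a ≠ 1` in `A` and all `k ≠ 1`, because a finite nonempty subset
of `ℤ × ℤ` is not invariant under a nontrivial translation. The theorem
`PLo.eq_bot_of_conj_ne` says that this is impossible.

A piecewise-linear map `f` has only finitely many boundary fixed points (fixed points not interior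
to the fixed-point set), and they are permuted in an increasing way, hence fixed, by every map
commuting with `f` (`PLo.apply_eq_of_mem_boundaryFixedPoints`). Two facts follow.

* Let `x` be a common fixed point of all `τ k`. Then `a` and its conjugates agree at `x`
  (`PLo.conj_apply_eq_of_fixed`): the component of the support of `a` around `x` has its left end
  fixed by each `τ k`, so a conjugate of `a` has the same slope there as `a`, and an element
  commuting with `a` whose slope there is `1` is the identity on the component. So taking one
  commutator gives `a ≠ 1` fixing all common fixed points.
* Let `u < 1` be a common fixed point. Some `k ≠ 1` has slope `1` at `u`
  (`PLo.exists_ne_one_hasSlope_one`), so `τ k` is the identity up to the next common fixed point,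
  and hence so is the commutator of `τ k` with any `a` as above. The second fact is where
  piecewise linearity is essential: if the slopes at `u` were injective on `ℤ × ℤ`, there would be
  `τ k` with slope arbitrarily close to `1`. A large power `h` of a single element carries points
  near one end of its support component to points near the other end, and commutes with `τ k`.
  Since `h` is affine on some interval, which `τ k` moves only slightly, `τ k` has equal slopes at
  the two ends. This is absurd, as points move away from one end and towards the other.

Only finitely many `u` are isolated from the right in the set of common fixed points, so finitely
many successive commutators turn an `a ≠ 1` into the identity without ever making it trivial.
-/

open Filter Set Topology

/-! ### Increasing piecewise-linear homeomorphisms -/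

namespace PLo

theorem strictMono_coe (f : PLo) : StrictMono f.1 := f.2.1

theorem mul_apply (f g : PLo) (x : unitInterval) : (f * g).1 x = f.1 (g.1 x) := rfl

theorem pow_apply (f : PLo) (n : ℕ) (x : unitInterval) : (f ^ n).1 x = f.1^[n] x := by
  induction n with
  | zero => rfl
  | succ n ih => rw [pow_succ', mul_apply, ih, Function.iterate_succ_apply']

theorem inv_apply_self (f : PLo) (x : unitInterval) : (f⁻¹).1 (f.1 x) = x :=
  f.1.symm_apply_apply x

theorem apply_inv_self (f : PLo) (x : unitInterval) : f.1 ((f⁻¹).1 x) = x :=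
  f.1.apply_symm_apply x

theorem inv_apply_eq_iff (f : PLo) {x y : unitInterval} : (f⁻¹).1 x = y ↔ x = f.1 y :=
  ⟨fun h => by rw [← h, apply_inv_self], fun h => by rw [h, inv_apply_self]⟩

theorem ext {f g : PLo} (h : ∀ x, f.1 x = g.1 x) : f = g :=
  Subtype.ext (Homeomorph.ext h)

theorem commute_apply {f g : PLo} (h : Commute f g) (x : unitInterval) :
    f.1 (g.1 x) = g.1 (f.1 x) := by
  rw [← mul_apply, h.eq, mul_apply]

theorem apply_zero (f : PLo) : f.1 0 = 0 := by
  have h : f.1 0 ≤ f.1 ((f⁻¹).1 0) := (strictMono_coe f).monotone unitInterval.nonneg'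
  rw [apply_inv_self] at h
  exact le_antisymm h unitInterval.nonneg'

theorem apply_one (f : PLo) : f.1 1 = 1 := by
  have h : f.1 ((f⁻¹).1 1) ≤ f.1 1 := (strictMono_coe f).monotone unitInterval.le_one'
  rw [apply_inv_self] at h
  exact le_antisymm unitInterval.le_one' h

/-- `f` is affine on some nondegenerate closed interval to the right of any point. -/
theorem exists_affine_right (f : PLo) {p : unitInterval} (hp : p < 1) :
    ∃ y, p < y ∧ ∃ m c : ℝ, ∀ z ∈ Icc p y, (f.1 z : ℝ) = m * z + c := by
  obtain ⟨B, hB, h⟩ := f.2.2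
  have : (B \ {p})ᶜ ∈ 𝓝[>] p := mem_nhdsWithin_of_mem_nhds
    ((hB.subset sdiff_subset).isClosed.isOpen_compl.mem_nhds (by simp))
  obtain ⟨y, hy, hs⟩ := (mem_nhdsGT_iff_exists_Ioo_subset' hp).1 this
  refine ⟨y, hy, h p y hy (disjoint_left.2 fun z hz hzB => hs hz ⟨hzB, ?_⟩)⟩
  rintro rfl
  exact lt_irrefl _ hz.1

/-- `f` is affine on some nondegenerate closed interval to the left of any point. -/
theorem exists_affine_left (f : PLo) {p : unitInterval} (hp : 0 < p) :
    ∃ y, y < p ∧ ∃ m c : ℝ, ∀ z ∈ Icc y p, (f.1 z : ℝ) = m * z + c := by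
  obtain ⟨B, hB, h⟩ := f.2.2
  have : (B \ {p})ᶜ ∈ 𝓝[<] p := mem_nhdsWithin_of_mem_nhds
    ((hB.subset sdiff_subset).isClosed.isOpen_compl.mem_nhds (by simp))
  obtain ⟨y, hy, hs⟩ := (mem_nhdsLT_iff_exists_Ioo_subset' hp).1 this
  refine ⟨y, hy, h y p hy (disjoint_left.2 fun z hz hzB => hs hz ⟨hzB, ?_⟩)⟩
  rintro rfl
  exact lt_irrefl _ hz.2

/-! ### Boundary fixed points -/

/-- The fixed points of `f` that do not lie in the interior of the fixed-point set of `f`. -/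
def boundaryFixedPoints (f : PLo) : Set unitInterval :=
  {p | f.1 p = p ∧ ¬ ∀ᶠ y in 𝓝 p, f.1 y = y}

/-- An affine function with two fixed points is the identity, so an open interval on which `f` is
affine contains at most one boundary fixed point. -/
theorem subsingleton_boundaryFixedPoints_inter_Ioo (f : PLo) {x y : unitInterval} {m c : ℝ}
    (h : ∀ z ∈ Icc x y, (f.1 z : ℝ) = m * z + c) :
    (boundaryFixedPoints f ∩ Ioo x y).Subsingleton := by
  rintro p ⟨hp, hpI⟩ q ⟨hq, hqI⟩
  by_contra hne
  have h1 := h p (Ioo_subset_Icc_self hpI)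
  have h2 := h q (Ioo_subset_Icc_self hqI)
  rw [hp.1] at h1
  rw [hq.1] at h2
  have hne' : (p : ℝ) - q ≠ 0 := sub_ne_zero.2 fun e => hne (Subtype.ext e)
  have hm : m = 1 := mul_right_cancel₀ hne' (by linarith)
  have hc : c = 0 := by rw [hm] at h1; linarith
  refine hp.2 (mem_of_superset (isOpen_Ioo.mem_nhds hpI) fun z hz => Subtype.ext ?_)
  rw [h z (Ioo_subset_Icc_self hz), hm, hc]
  ring

theorem finite_boundaryFixedPoints (f : PLo) : (boundaryFixedPoints f).Finite := by
  by_contra hinf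
  obtain ⟨p, hp⟩ := Set.Infinite.exists_accPt_principal hinf
  rw [accPt_iff_frequently_nhdsNE, ← Iio_union_Ioi, nhdsWithin_union, frequently_sup] at hp
  rcases hp with hp | hp
  · obtain ⟨e, he⟩ := (hp.and_eventually self_mem_nhdsWithin).exists
    obtain ⟨y, hy, m, c, h⟩ := exists_affine_left f (lt_of_le_of_lt unitInterval.nonneg' he.2)
    obtain ⟨e₁, h1, h1'⟩ := (hp.and_eventually (Ioo_mem_nhdsLT hy)).exists
    obtain ⟨e₂, h2, h2'⟩ := (hp.and_eventually (Ioo_mem_nhdsLT h1'.2)).exists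
    exact h2'.1.ne (subsingleton_boundaryFixedPoints_inter_Ioo f h ⟨h1, h1'⟩
      ⟨h2, h1'.1.trans h2'.1, h2'.2⟩)
  · obtain ⟨e, he⟩ := (hp.and_eventually self_mem_nhdsWithin).exists
    obtain ⟨y, hy, m, c, h⟩ := exists_affine_right f (lt_of_lt_of_le he.2 unitInterval.le_one')
    obtain ⟨e₁, h1, h1'⟩ := (hp.and_eventually (Ioo_mem_nhdsGT hy)).exists
    obtain ⟨e₂, h2, h2'⟩ := (hp.and_eventually (Ioo_mem_nhdsGT h1'.1)).exists
    exact h2'.2.ne (subsingleton_boundaryFixedPoints_inter_Ioo f h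
      ⟨h2, h2'.1, h2'.2.trans h1'.2⟩ ⟨h1, h1'⟩)

theorem mapsTo_boundaryFixedPoints {f g : PLo} (h : Commute f g) :
    MapsTo g.1 (boundaryFixedPoints f) (boundaryFixedPoints f) := by
  rintro p ⟨hp, hp'⟩
  refine ⟨by rw [commute_apply h, hp], fun hev => hp' ?_⟩
  filter_upwards [g.1.continuous.continuousAt.eventually hev] with y hy
  rw [commute_apply h] at hy
  exact g.1.injective hy

/-- An increasing map permuting a finite set fixes it pointwise, so an element commuting with `f`
fixes every boundary fixed point of `f`. -/
theorem apply_eq_of_mem_boundaryFixedPoints {f g : PLo} (h : Commute f g) {p : unitInterval}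
    (hp : p ∈ boundaryFixedPoints f) : g.1 p = p := by
  have key : ∀ g : PLo, Commute f g → ¬ p < g.1 p := by
    intro g h hlt
    refine infinite_range_of_injective
      ((strictMono_coe g).strictMono_iterate_of_lt_map hlt).injective
      ((finite_boundaryFixedPoints f).subset ?_)
    rintro _ ⟨n, rfl⟩
    exact (mapsTo_boundaryFixedPoints h).iterate n hp
  refine le_antisymm (not_lt.1 (key g h)) (not_lt.1 fun hlt => key g⁻¹ h.inv_right ?_)
  simpa [inv_apply_self] using strictMono_coe (g⁻¹) hlt

/-- A point moved by `f` lies in a component of the support of `f`; the ends of that component are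
boundary fixed points. -/
theorem exists_orbital (f : PLo) {z : unitInterval} (hz : f.1 z ≠ z) :
    ∃ p q, p ∈ boundaryFixedPoints f ∧ q ∈ boundaryFixedPoints f ∧ p < z ∧ z < q ∧
      ∀ y, p < y → y < q → f.1 y ≠ y := by
  have hcl : IsClosed {y | f.1 y = y} := isClosed_eq f.1.continuous continuous_id
  obtain ⟨p, hp, hpm⟩ := (hcl.inter isClosed_Iic).isCompact.exists_isGreatest
    (s := {y | f.1 y = y} ∩ Iic z) ⟨0, (apply_zero f), unitInterval.nonneg'⟩
  obtain ⟨q, hq, hqm⟩ := (hcl.inter isClosed_Ici).isCompact.exists_isLeast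
    (s := {y | f.1 y = y} ∩ Ici z) ⟨1, (apply_one f), unitInterval.le_one'⟩
  have hpz : p < z := lt_of_le_of_ne hp.2 fun e => hz (e ▸ hp.1)
  have hzq : z < q := lt_of_le_of_ne hq.2 fun e => hz (e ▸ hq.1)
  have hno : ∀ y, p < y → y < q → f.1 y ≠ y := by
    intro y h1 h2 h
    rcases le_total y z with h3 | h3
    · exact h1.not_ge (hpm ⟨h, h3⟩)
    · exact h2.not_ge (hqm ⟨h, h3⟩)
  refine ⟨p, q, ⟨hp.1, fun hev => ?_⟩, ⟨hq.1, fun hev => ?_⟩, hpz, hzq, hno⟩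
  · have := nhdsGT_neBot_of_exists_gt ⟨z, hpz⟩
    obtain ⟨y, hy, hyI⟩ :=
      ((hev.filter_mono nhdsWithin_le_nhds).and (Ioo_mem_nhdsGT hpz)).exists
    exact hno y hyI.1 (hyI.2.trans hzq) hy
  · have := nhdsLT_neBot_of_exists_lt ⟨z, hzq⟩
    obtain ⟨y, hy, hyI⟩ :=
      ((hev.filter_mono nhdsWithin_le_nhds).and (Ioo_mem_nhdsLT hzq)).exists
    exact hno y (hpz.trans hyI.1) hyI.2 hy

/-- If `c` commutes with every element of `S` and is the identity just to the right of
`p`, then it stays the identity up to the next common fixed point of `S`. -/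
theorem apply_eq_of_eventually_right {c : PLo} {S : Set PLo} (hS : ∀ g ∈ S, Commute c g)
    {p x : unitInterval} (hpx : p < x) (hc : ∀ᶠ y in 𝓝[>] p, c.1 y = y)
    (hno : ∀ y, p < y → y ≤ x → ∃ g ∈ S, g.1 y ≠ y) : c.1 x = x := by
  by_contra hx
  obtain ⟨p', q', hp', -, hpx', hxq', hmv⟩ := exists_orbital c hx
  have h1 : p' ≤ p := by
    by_contra hlt
    obtain ⟨g, hg, hne⟩ := hno p' (not_le.1 hlt) hpx'.le
    exact hne (apply_eq_of_mem_boundaryFixedPoints (hS g hg) hp')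
  have := nhdsGT_neBot_of_exists_gt ⟨x, hpx⟩
  obtain ⟨y, hy, hyI⟩ := (hc.and (Ioo_mem_nhdsGT hpx)).exists
  exact hmv y (h1.trans_lt hyI.1) (hyI.2.trans hxq') hy

/-! ### One-sided slopes at a fixed point -/

/-- Near `p` within `s`, the map `f` is the dilation about `p` with ratio `m`. It is used with
`s` a one-sided neighbourhood of a fixed point `p` of `f`, where `m` is the one-sided slope. -/
def HasSlope (f : PLo) (p : unitInterval) (s : Set unitInterval) (m : ℝ) : Prop :=
  ∀ᶠ z in 𝓝[s] p, (f.1 z : ℝ) - p = m * (z - p)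

theorem exists_hasSlope_Ioi (f : PLo) {p : unitInterval} (hp : p < 1) (hfp : f.1 p = p) :
    ∃ m, 0 < m ∧ HasSlope f p (Ioi p) m := by
  obtain ⟨y, hy, m, c, h⟩ := exists_affine_right f hp
  have h0 := h p ⟨le_rfl, hy.le⟩
  rw [hfp] at h0
  have h1 := h y ⟨hy.le, le_rfl⟩
  have h2 : (p : ℝ) < f.1 y := by
    have := strictMono_coe f hy
    rwa [hfp] at this
  refine ⟨m, ?_, ?_⟩
  · have hy' : (0 : ℝ) < y - p := sub_pos.2 hy
    by_contra hm
    nlinarith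
  · filter_upwards [Ioo_mem_nhdsGT hy] with z hz
    rw [h z (Ioo_subset_Icc_self hz)]
    linarith

theorem exists_hasSlope_Iio (f : PLo) {p : unitInterval} (hp : 0 < p) (hfp : f.1 p = p) :
    ∃ m, 0 < m ∧ HasSlope f p (Iio p) m := by
  obtain ⟨y, hy, m, c, h⟩ := exists_affine_left f hp
  have h0 := h p ⟨hy.le, le_rfl⟩
  rw [hfp] at h0
  have h1 := h y ⟨le_rfl, hy.le⟩
  have h2 : (f.1 y : ℝ) < p := by
    have := strictMono_coe f hy
    rwa [hfp] at this
  refine ⟨m, ?_, ?_⟩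
  · have hy' : (y : ℝ) - p < 0 := sub_neg.2 hy
    by_contra hm
    nlinarith
  · filter_upwards [Ioo_mem_nhdsLT hy] with z hz
    rw [h z (Ioo_subset_Icc_self hz)]
    linarith

theorem HasSlope.mul_Ioi {f g : PLo} {p : unitInterval} {m n : ℝ}
    (hf : HasSlope f p (Ioi p) m) (hg : HasSlope g p (Ioi p) n) (hgp : g.1 p = p) :
    HasSlope (f * g) p (Ioi p) (m * n) := by
  have ht : Tendsto g.1 (𝓝[>] p) (𝓝[>] p) := by
    refine tendsto_nhdsWithin_iff.2 ⟨?_, ?_⟩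
    · have := g.1.continuous.continuousAt (x := p)
      rw [ContinuousAt, hgp] at this
      exact this.mono_left nhdsWithin_le_nhds
    · filter_upwards [self_mem_nhdsWithin] with z hz
      have := strictMono_coe g hz
      rwa [hgp] at this
  filter_upwards [hg, ht.eventually hf] with z h1 h2
  rw [mul_apply, h2, h1]
  ring

theorem hasSlope_one (p : unitInterval) (s : Set unitInterval) : HasSlope (1 : PLo) p s 1 :=
  Eventually.of_forall fun z => by simp

theorem HasSlope.unique {f : PLo} {p : unitInterval} {m n : ℝ} (hp : p < 1)
    (hm : HasSlope f p (Ioi p) m) (hn : HasSlope f p (Ioi p) n) : m = n := by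
  have := nhdsGT_neBot_of_exists_gt ⟨1, hp⟩
  obtain ⟨z, ⟨h1, h2⟩, h3⟩ := ((hm.and hn).and (Ioo_mem_nhdsGT hp)).exists
  have : (0 : ℝ) < z - p := sub_pos.2 h3.1
  exact mul_right_cancel₀ this.ne' (h1.symm.trans h2)

theorem HasSlope.eventually_eq {f : PLo} {p : unitInterval} {s : Set unitInterval}
    (h : HasSlope f p s 1) : ∀ᶠ z in 𝓝[s] p, f.1 z = z := by
  filter_upwards [h] with z hz
  exact Subtype.ext (by linarith)

/-- Conjugation by `t` does not change the slope at a fixed point of `t`. -/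
theorem eventually_inv_mul_conj_apply {b t : PLo} {p : unitInterval} (hp : p < 1)
    (hbp : b.1 p = p) (htp : t.1 p = p) :
    ∀ᶠ z in 𝓝[>] p, (b⁻¹ * (t * b * t⁻¹)).1 z = z := by
  have hb' : (b⁻¹).1 p = p := (inv_apply_eq_iff b).2 hbp.symm
  have ht' : (t⁻¹).1 p = p := (inv_apply_eq_iff t).2 htp.symm
  obtain ⟨m, hm, hbm⟩ := exists_hasSlope_Ioi b hp hbp
  obtain ⟨m', hm', hbm'⟩ := exists_hasSlope_Ioi (b⁻¹) hp hb'
  obtain ⟨n, hn, htn⟩ := exists_hasSlope_Ioi t hp htp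
  obtain ⟨n', hn', htn'⟩ := exists_hasSlope_Ioi (t⁻¹) hp ht'
  have e1 : m' * m = 1 := by
    have := hbm'.mul_Ioi hbm hbp
    rw [inv_mul_cancel] at this
    exact this.unique hp (hasSlope_one _ _)
  have e2 : n * n' = 1 := by
    have := htn.mul_Ioi htn' ht'
    rw [mul_inv_cancel] at this
    exact this.unique hp (hasSlope_one _ _)
  have h := hbm'.mul_Ioi ((htn.mul_Ioi hbm hbp).mul_Ioi htn' ht')
    (by rw [mul_apply, mul_apply, ht', hbp, htp])
  rw [show m' * (n * m * n') = (m' * m) * (n * n') by ring, e1, e2, one_mul] at h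
  exact h.eventually_eq

/-- Suppose `f` contracts `S` towards `p` linearly with ratio `l`. Then any `g` commuting with `f`
that is a dilation near `p` is the same dilation on all of `S`. -/
theorem apply_eq_iff_of_contraction {f g : PLo} {p : unitInterval} {S : Set unitInterval}
    {l n : ℝ} (hcomm : Commute f g) (hS : MapsTo f.1 S S) (hl : 0 < l) (hl1 : l < 1)
    (hf : ∀ z ∈ S, (f.1 z : ℝ) - p = l * (z - p)) (hg : HasSlope g p S n)
    {z w : unitInterval} (hz : z ∈ S) (hw : w ∈ S) :
    g.1 z = w ↔ (w : ℝ) - p = n * (z - p) := by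
  have hit : ∀ k : ℕ, ∀ y ∈ S, ((f.1^[k] y : unitInterval) : ℝ) - p = l ^ k * (y - p) := by
    intro k y hy
    induction k with
    | zero => simp
    | succ k ih =>
      rw [Function.iterate_succ_apply', hf _ (hS.iterate k hy), ih]
      ring
  have ht : Tendsto (fun k => f.1^[k] z) atTop (𝓝[S] p) := by
    refine tendsto_nhdsWithin_iff.2 ⟨?_, Eventually.of_forall fun k => hS.iterate k hz⟩
    rw [tendsto_subtype_rng]
    have h1 : Tendsto (fun k : ℕ => (p : ℝ) + l ^ k * ((z : ℝ) - p)) atTop (𝓝 (p + 0 * (z - p))) :=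
      ((tendsto_pow_atTop_nhds_zero_of_lt_one hl.le hl1).mul_const _).const_add _
    rw [zero_mul, add_zero] at h1
    refine h1.congr fun k => ?_
    rw [← hit k z hz]
    ring
  obtain ⟨k, hk⟩ := (ht.eventually hg).exists
  have hc : g.1 (f.1^[k] z) = f.1^[k] (g.1 z) :=
    (Function.Commute.iterate_right (fun y => (commute_apply hcomm y).symm) k) z
  rw [hc, hit k z hz] at hk
  have hlk : l ^ k ≠ 0 := (pow_pos hl k).ne'
  constructor
  · rintro rfl
    rw [hit k _ hw] at hk
    refine mul_left_cancel₀ hlk (hk.trans ?_)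
    ring
  · intro h
    refine f.1.injective.iterate k (Subtype.ext ?_)
    have h2 := hit k w hw
    rw [h] at h2
    linarith

/-! ### Commuting elements of rank two -/

/-- A positive-valued character of `ℤ × ℤ` with trivial kernel takes values arbitrarily close to
`1` from below: by Dirichlet's approximation theorem, the logarithm takes nonzero values that are
arbitrarily small. -/
theorem exists_character_mem_Ioo (L : Multiplicative (ℤ × ℤ) →* ℝ) (hpos : ∀ k, 0 < L k)
    (hne : ∀ k, k ≠ 1 → L k ≠ 1) {r : ℝ} (hr : r < 1) : ∃ k, r < L k ∧ L k < 1 := by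
  wlog hr0 : 0 < r generalizing r
  · obtain ⟨k, h1, h2⟩ := this (r := 1 / 2) (by norm_num) (by norm_num)
    exact ⟨k, by linarith, h2⟩
  have hinv : ∀ k, L k⁻¹ = (L k)⁻¹ := fun k =>
    eq_inv_of_mul_eq_one_left (by rw [← map_mul, inv_mul_cancel, map_one])
  set a := L (Multiplicative.ofAdd (1, 0)) with ha
  set b := L (Multiplicative.ofAdd (0, 1)) with hb
  have hform : ∀ m n : ℤ, Real.log (L (Multiplicative.ofAdd (m, n))) =
      m * Real.log a + n * Real.log b := by
    intro m n
    have : Multiplicative.ofAdd ((m, n) : ℤ × ℤ) =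
        Multiplicative.ofAdd ((1, 0) : ℤ × ℤ) ^ m * Multiplicative.ofAdd ((0, 1) : ℤ × ℤ) ^ n := by
      rw [← ofAdd_zsmul, ← ofAdd_zsmul, ← ofAdd_add]
      simp
    rw [this, map_mul, map_zpow' L hinv, map_zpow' L hinv,
      Real.log_mul (zpow_ne_zero _ (hpos _).ne') (zpow_ne_zero _ (hpos _).ne'),
      Real.log_zpow, Real.log_zpow]
  have hlb : Real.log b ≠ 0 := by
    have h1 : b ≠ 1 := hne _ (by decide)
    exact Real.log_ne_zero_of_pos_of_ne_one (hpos _) h1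
  have hlr : 0 < -Real.log r := neg_pos.2 (Real.log_neg hr0 hr)
  obtain ⟨N, hN⟩ := exists_nat_gt (|Real.log b| / -Real.log r)
  obtain ⟨j, k, hk, -, hjk⟩ := Real.exists_int_int_abs_mul_sub_le (Real.log a / Real.log b)
    (Nat.succ_pos N)
  have hsmall : |Real.log (L (Multiplicative.ofAdd (k, -j)))| < -Real.log r := by
    rw [hform]
    have e : (k : ℝ) * Real.log a + ((-j : ℤ) : ℝ) * Real.log b =
        (k * (Real.log a / Real.log b) - j) * Real.log b := by
      push_cast
      field_simp
      ring
    rw [e, abs_mul]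
    rw [div_lt_iff₀ hlr] at hN
    have hN0 : (0 : ℝ) < ((N.succ : ℕ) : ℝ) + 1 := by positivity
    calc _ ≤ 1 / (((N.succ : ℕ) : ℝ) + 1) * |Real.log b| := by gcongr
      _ < -Real.log r := by
        rw [div_mul_eq_mul_div, one_mul, div_lt_iff₀ hN0]
        push_cast
        nlinarith
  have hne1 : Multiplicative.ofAdd ((k, -j) : ℤ × ℤ) ≠ 1 := by
    intro h
    have := congrArg (fun x => (Multiplicative.toAdd x).1) h
    simp at this
    omega
  have hL := hne _ hne1
  rw [abs_lt, neg_neg] at hsmall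
  rcases lt_or_gt_of_ne hL with h | h
  · exact ⟨_, (Real.log_lt_log_iff hr0 (hpos _)).1 hsmall.1, h⟩
  · refine ⟨(Multiplicative.ofAdd ((k, -j) : ℤ × ℤ))⁻¹, ?_, ?_⟩
    · refine (Real.log_lt_log_iff hr0 (hpos _)).1 ?_
      rw [hinv, Real.log_inv]
      linarith
    · rw [hinv]
      exact inv_lt_one_of_one_lt₀ h

/-- The dilation about `u` with ratio in `[0, 1]` maps `[u, x]` into itself. -/
theorem exists_coe_sub_eq {u x : unitInterval} (hux : u ≤ x) {m : ℝ} (h0 : 0 ≤ m) (h1 : m ≤ 1) :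
    ∃ w : unitInterval, (w : ℝ) - u = m * (x - u) := by
  have hx : (0 : ℝ) ≤ x - u := sub_nonneg.2 hux
  refine ⟨⟨u + m * (x - u), ?_, ?_⟩, by simp⟩
  · have := u.2.1
    positivity
  · have := x.2.2
    nlinarith

/-- Some nontrivial element of a `ℤ × ℤ` of commuting maps fixing `u` has slope `1` to the right
of `u`. Otherwise the slopes at `u` would accumulate at `1`. Let `f` have slope less than `1` and
let `v` be the next fixed point of `f`. A large power `h` of `f⁻¹` carries an interval on which it
is affine from near `u` to near `v`. A `g` with slope `n < 1` at `u` close enough to `1` commutes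
with `h`, so it is a dilation with the same ratio `n` near `v`; but it moves points away from
`v`. -/
theorem exists_ne_one_hasSlope_one (τ : Multiplicative (ℤ × ℤ) →* PLo) {u : unitInterval}
    (hu : u < 1) (hfix : ∀ t, (τ t).1 u = u) : ∃ k, k ≠ 1 ∧ HasSlope (τ k) u (Ioi u) 1 := by
  by_contra! hcon
  have hcomm : ∀ s t, Commute (τ s) (τ t) := fun s t => (Commute.all s t).map τ
  choose L hLpos hL using fun t => exists_hasSlope_Ioi (τ t) hu (hfix t)
  let Λ : Multiplicative (ℤ × ℤ) →* ℝ :=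
    { toFun := L
      map_one' := by
        have := hL 1
        rw [map_one] at this
        exact this.unique hu (hasSlope_one _ _)
      map_mul' := fun s t => by
        have := hL (s * t)
        rw [map_mul] at this
        exact this.unique hu ((hL s).mul_Ioi (hL t) (hfix t)) }
  have hdense : ∀ r : ℝ, r < 1 → ∃ k, r < L k ∧ L k < 1 := fun r hr =>
    exists_character_mem_Ioo Λ hLpos (fun k hk h => hcon k hk (h ▸ hL k)) hr
  obtain ⟨t₀, -, hl1⟩ := hdense 0 one_pos
  have hl0 := hLpos t₀
  have hcg : ∀ k, Commute (τ t₀) (τ k) := hcomm t₀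
  have hfu := hfix t₀
  have hfs := hL t₀
  generalize L t₀ = l at hl0 hl1 hfs
  generalize τ t₀ = f at hcg hfu hfs
  -- `f` is the dilation with ratio `l` on `(u, x₀]`.
  obtain ⟨y, hy, hyS⟩ := (mem_nhdsGT_iff_exists_Ioo_subset' hu).1 hfs
  obtain ⟨x₀, hux₀, hx₀y⟩ := exists_between (mem_Ioi.1 hy)
  have hlin : ∀ z ∈ Ioc u x₀, (f.1 z : ℝ) - u = l * (z - u) :=
    fun z hz => hyS ⟨hz.1, hz.2.trans_lt hx₀y⟩
  have hlt : ∀ z ∈ Ioc u x₀, f.1 z < z := by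
    intro z hz
    have h1 := hlin z hz
    have h2 : (0 : ℝ) < z - u := sub_pos.2 hz.1
    have : (f.1 z : ℝ) < z := by nlinarith
    exact this
  have hmaps : MapsTo f.1 (Ioc u x₀) (Ioc u x₀) := fun z hz =>
    ⟨by simpa [hfu] using strictMono_coe f hz.1, (hlt z hz).le.trans hz.2⟩
  have hx₀ : x₀ ∈ Ioc u x₀ := ⟨hux₀, le_rfl⟩
  -- The component `(u, v)` of the support of `f`.
  obtain ⟨p, v, hp, hv, hpx, hxv, hno⟩ := exists_orbital f (hlt x₀ hx₀).ne
  have hpu : p ≤ u := by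
    by_contra h
    exact (hlt p ⟨not_le.1 h, hpx.le⟩).ne hp.1
  have hvfix : ∀ k, (τ k).1 v = v := fun k => apply_eq_of_mem_boundaryFixedPoints (hcg k) hv
  have hv0 : 0 < v := lt_of_le_of_lt unitInterval.nonneg' hxv
  have hFv : (f⁻¹).1 v = v := (inv_apply_eq_iff f).2 hv.1.symm
  obtain ⟨κ, hκ0, hκ⟩ := exists_hasSlope_Iio f⁻¹ hv0 hFv
  obtain ⟨y', hy', hyS'⟩ := (mem_nhdsLT_iff_exists_Ioo_subset' hv0).1 hκ
  obtain ⟨y₀, hyy₀, hy₀v⟩ := exists_between (mem_Iio.1 hy')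
  have hlin' : ∀ z ∈ Ico y₀ v, ((f⁻¹).1 z : ℝ) - v = κ * (z - v) :=
    fun z hz => hyS' ⟨hyy₀.trans_le hz.1, hz.2⟩
  -- The iterates of `x₁ = f x₀` under `f⁻¹` increase to `v`.
  set x₁ := f.1 x₀ with hx₁
  have hx₁m : x₁ ∈ Ioc u x₀ := hmaps hx₀
  have hx₁x₀ : x₁ < x₀ := hlt x₀ hx₀
  have hF1 : x₁ < (f⁻¹).1 x₁ := by rwa [hx₁, inv_apply_self]
  have hmono : StrictMono fun n => (f⁻¹).1^[n] x₁ :=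
    (strictMono_coe f⁻¹).strictMono_iterate_of_lt_map hF1
  have hbelow : ∀ n : ℕ, ∀ z, z < v → (f⁻¹).1^[n] z < v := by
    intro n z hz
    have := (strictMono_coe f⁻¹).iterate n hz
    rwa [Function.iterate_fixed hFv] at this
  have hlim : Tendsto (fun n => (f⁻¹).1^[n] x₁) atTop (𝓝 v) := by
    have ht := tendsto_atTop_iSup hmono.monotone
    have hfx := isFixedPt_of_tendsto_iterate ht (f⁻¹).1.continuous.continuousAt
    have hle : (⨆ n, (f⁻¹).1^[n] x₁) ≤ v := iSup_le fun n => (hbelow n _ (hx₁x₀.trans hxv)).le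
    have hge : x₁ ≤ ⨆ n, (f⁻¹).1^[n] x₁ := le_iSup (fun n => (f⁻¹).1^[n] x₁) 0
    rcases hle.eq_or_lt with h | h
    · rwa [h] at ht
    · exact absurd ((inv_apply_eq_iff f).1 hfx).symm
        (hno _ (hpu.trans_lt (hx₁m.1.trans_le hge)) h)
  obtain ⟨N, hN⟩ := (hlim.eventually (Ioi_mem_nhds hy₀v)).exists
  replace hN : y₀ < (f⁻¹).1^[N] x₁ := hN
  have hκ1 : κ < 1 := by
    have h1 := hlin' _ ⟨hN.le, hbelow N _ (hx₁x₀.trans hxv)⟩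
    have h2 : (f⁻¹).1^[N] x₁ < (f⁻¹).1 ((f⁻¹).1^[N] x₁) := by
      have := hmono (Nat.lt_succ_self N)
      simpa only [Function.iterate_succ_apply'] using this
    have h2' : (((f⁻¹).1^[N] x₁ : unitInterval) : ℝ) < (f⁻¹).1 ((f⁻¹).1^[N] x₁) := h2
    have h3 : (((f⁻¹).1^[N] x₁ : unitInterval) : ℝ) < v := hbelow N _ (hx₁x₀.trans hxv)
    nlinarith
  have hmaps' : MapsTo (f⁻¹).1 (Ico y₀ v) (Ico y₀ v) := by
    intro z hz
    refine ⟨?_, by simpa using hbelow 1 z hz.2⟩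
    have h1 := hlin' z hz
    have h2 : (z : ℝ) < v := hz.2
    have h3 : (z : ℝ) < (f⁻¹).1 z := by nlinarith
    exact hz.1.trans (le_of_lt (show z < (f⁻¹).1 z from h3))
  -- `h` is affine on `[x₁, b]` and maps it into `[y₀, v)`.
  obtain ⟨h, hh⟩ : ∃ h : PLo, h = (f⁻¹) ^ N := ⟨_, rfl⟩
  have hhit : ∀ z, h.1 z = (f⁻¹).1^[N] z := hh ▸ pow_apply f⁻¹ N
  have hhI : ∀ z ∈ Icc x₁ x₀, h.1 z ∈ Ico y₀ v := by
    intro z hz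
    refine ⟨?_, ?_⟩
    · refine (hN.le).trans ?_
      rw [← hhit]
      exact (strictMono_coe h).monotone hz.1
    · rw [hhit]
      exact hbelow N z (hz.2.trans_lt hxv)
  obtain ⟨b', hb', m, c, hmc⟩ := exists_affine_right h (hx₁x₀.trans_le unitInterval.le_one')
  obtain ⟨b, hb⟩ : ∃ b, b = min b' x₀ := ⟨_, rfl⟩
  have hab : x₁ < b := hb ▸ lt_min hb' hx₁x₀
  have hbx₀ : b ≤ x₀ := hb ▸ min_le_right _ _
  have hbb' : b ≤ b' := hb ▸ min_le_left _ _
  -- The slope `n` of `g` at `u` is so close to `1` that `b`, `g b` and `g (g b)` are in `[x₁, b]`.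
  have hu1 : (0 : ℝ) < x₁ - u := sub_pos.2 hx₁m.1
  have hu2 : (x₁ : ℝ) - u < b - u := sub_lt_sub_right (show (x₁ : ℝ) < b from hab) _
  have hu3 : (0 : ℝ) < b - u := hu1.trans hu2
  set r : ℝ := ((x₁ : ℝ) - u) / (b - u) with hr
  have hr1 : r < 1 := (div_lt_one hu3).2 hu2
  have hr0 : 0 < r := div_pos hu1 hu3
  have hrb : r * (b - u) = x₁ - u := div_mul_cancel₀ _ hu3.ne'
  obtain ⟨k, hk1, hk2⟩ := hdense ((1 + r) / 2) (by linarith)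
  set n := L k with hn
  have hn0 : 0 < n := by linarith
  have hnr : r < n * n := by nlinarith [sq_nonneg (1 - r)]
  have hgf : ∀ z ∈ Ioc u x₀, ((τ k).1 z : ℝ) - u = n * (z - u) := by
    intro z hz
    obtain ⟨w, hw⟩ := exists_coe_sub_eq hz.1.le hn0.le hk2.le
    have hz' : (0 : ℝ) < z - u := sub_pos.2 hz.1
    have hwS : w ∈ Ioc u x₀ := by
      refine ⟨?_, le_trans ?_ hz.2⟩
      · have h1 : (0 : ℝ) < w - u := by rw [hw]; positivity
        have h2 : (u : ℝ) < w := sub_pos.1 h1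
        exact h2
      · have : (w : ℝ) ≤ z := by nlinarith
        exact this
    have := (apply_eq_iff_of_contraction (hcg k) hmaps hl0 hl1 hlin
      ((hL k).filter_mono (nhdsWithin_mono _ Ioc_subset_Ioi_self)) hz hwS).2 hw
    rw [this, hw]
  obtain ⟨ν, -, hν⟩ := exists_hasSlope_Iio (τ k) hv0 (hvfix k)
  have hcF : Commute f⁻¹ (τ k) := (hcg k).inv_left
  have hch : Commute h (τ k) := hh ▸ hcF.pow_left N
  have hgv : ∀ z ∈ Icc x₁ x₀, (τ k).1 z ∈ Icc x₁ x₀ →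
      (h.1 ((τ k).1 z) : ℝ) - v = ν * (h.1 z - v) := by
    intro z hz hgz
    refine (apply_eq_iff_of_contraction hcF hmaps' hκ0 hκ1 hlin'
      (hν.filter_mono (nhdsWithin_mono _ Ico_subset_Iio_self)) (hhI z hz) (hhI _ hgz)).1 ?_
    rw [commute_apply hch]
  have hbS : b ∈ Ioc u x₀ := ⟨hx₁m.1.trans hab, hbx₀⟩
  have e1 := hgf b hbS
  have hg1 : (τ k).1 b ∈ Icc x₁ b := by
    constructor
    · have : (x₁ : ℝ) ≤ (τ k).1 b := by nlinarith
      exact this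
    · have : ((τ k).1 b : ℝ) ≤ b := by nlinarith
      exact this
  have e2 := hgf _ ⟨hx₁m.1.trans_le hg1.1, hg1.2.trans hbx₀⟩
  have hg2 : (τ k).1 ((τ k).1 b) ∈ Icc x₁ b := by
    constructor
    · have : (x₁ : ℝ) ≤ (τ k).1 ((τ k).1 b) := by nlinarith
      exact this
    · have h1 : ((τ k).1 b : ℝ) ≤ b := hg1.2
      have h2 : (x₁ : ℝ) ≤ (τ k).1 b := hg1.1
      have h3 : ((τ k).1 ((τ k).1 b) : ℝ) ≤ b := by nlinarith
      exact h3
  have d1 := hgv b ⟨hab.le, hbx₀⟩ ⟨hg1.1, hg1.2.trans hbx₀⟩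
  have d2 := hgv _ ⟨hg1.1, hg1.2.trans hbx₀⟩ ⟨hg2.1, hg2.2.trans hbx₀⟩
  have a0 := hmc b ⟨hab.le, hbb'⟩
  have a1 := hmc _ ⟨hg1.1, hg1.2.trans hbb'⟩
  have a2 := hmc _ ⟨hg2.1, hg2.2.trans hbb'⟩
  have i1 : (h.1 ((τ k).1 b) : ℝ) < h.1 b := by
    have : ((τ k).1 b : ℝ) < b := by nlinarith
    exact strictMono_coe h (show (τ k).1 b < b from this)
  have i2 : (h.1 b : ℝ) < v := (hhI b ⟨hab.le, hbx₀⟩).2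
  -- The increments of `h` along `b`, `g b`, `g (g b)` scale by `n` and also by `ν`.
  have k1 : (h.1 ((τ k).1 ((τ k).1 b)) : ℝ) - h.1 ((τ k).1 b) =
      n * (h.1 ((τ k).1 b) - h.1 b) := by
    rw [a0, a1, a2]
    linear_combination m * e2 - m * e1
  have k2 : (h.1 ((τ k).1 ((τ k).1 b)) : ℝ) - h.1 ((τ k).1 b) =
      ν * (h.1 ((τ k).1 b) - h.1 b) := by
    linear_combination d2 - d1
  have hnν : n = ν := mul_right_cancel₀ (sub_neg.2 i1).ne (k1.symm.trans k2)
  rw [← hnν] at d1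
  nlinarith

/-! ### Abelian subgroups normalized by `ℤ × ℤ` -/

theorem conj_mem_boundaryFixedPoints {b : PLo} (t : PLo) {p : unitInterval}
    (hp : p ∈ boundaryFixedPoints b) : t.1 p ∈ boundaryFixedPoints (t * b * t⁻¹) := by
  refine ⟨by rw [mul_apply, mul_apply, inv_apply_self, hp.1], fun hev => hp.2 ?_⟩
  filter_upwards [t.1.continuous.continuousAt.eventually hev] with y hy
  rw [mul_apply, mul_apply, inv_apply_self] at hy
  exact t.1.injective hy

/-- If a conjugate of `b` by `t` commutes with `b`, then it agrees with `b` at each fixed point `x`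
of `t`: the component `(p, q)` of the support of `b` around `x` is preserved by `t`, so `b` and its
conjugate have the same slope at `p`, and their quotient is the identity up to `x`. -/
theorem conj_apply_eq_of_fixed {b t : PLo} (hc : Commute b (t * b * t⁻¹)) {x : unitInterval}
    (htx : t.1 x = x) : (t * b * t⁻¹).1 x = b.1 x := by
  have htx' : (t⁻¹).1 x = x := (inv_apply_eq_iff t).2 htx.symm
  by_cases hbx : b.1 x = x
  · rw [mul_apply, mul_apply, htx', hbx, htx]
  obtain ⟨p, q, hp, -, hpx, hxq, hno⟩ := exists_orbital b hbx
  have hc' : Commute b (t⁻¹ * b * t⁻¹⁻¹) := by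
    have h := congrArg (fun z => t⁻¹ * z * t) hc.eq
    simp only [mul_assoc, inv_mul_cancel, mul_one, inv_mul_cancel_left] at h
    simpa [Commute, SemiconjBy, mul_assoc] using h.symm
  -- An `s` that fixes `x` sends `p` to a fixed point of `b` to the left of `x`, which cannot lie
  -- in `(p, x)`.
  have key : ∀ s : PLo, Commute b (s * b * s⁻¹) → s.1 x = x → ¬ p < s.1 p := fun s hs hsx hlt =>
    hno _ hlt ((hsx ▸ strictMono_coe s hpx : s.1 p < x).trans hxq)
      (apply_eq_of_mem_boundaryFixedPoints hs.symm (conj_mem_boundaryFixedPoints s hp))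
  have htp : t.1 p = p := by
    refine le_antisymm (not_lt.1 (key t hc htx)) (not_lt.1 fun hlt => key t⁻¹ hc' htx' ?_)
    simpa [inv_apply_self] using strictMono_coe t⁻¹ hlt
  have h := apply_eq_of_eventually_right (c := b⁻¹ * (t * b * t⁻¹)) (S := {b})
    (by
      rintro g rfl
      exact (Commute.refl g).inv_left.mul_left hc.symm)
    hpx (eventually_inv_mul_conj_apply (hpx.trans_le unitInterval.le_one') hp.1 htp)
    fun y h1 h2 => ⟨b, rfl, hno y h1 (h2.trans_lt hxq)⟩
  rw [mul_apply] at h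
  exact (inv_apply_eq_iff b).1 h

/-- If `a` is the identity on a set stable under `t⁻¹`, so is `a⁻¹ t a t⁻¹`. -/
theorem inv_mul_conj_apply_eq {a t : PLo} {Y : Set unitInterval} (ha : ∀ x ∈ Y, a.1 x = x)
    (hY : ∀ x ∈ Y, (t⁻¹).1 x ∈ Y) {x : unitInterval} (hx : x ∈ Y) :
    (a⁻¹ * (t * a * t⁻¹)).1 x = x := by
  rw [mul_apply, mul_apply, mul_apply, ha _ (hY x hx), apply_inv_self]
  exact (inv_apply_eq_iff a).2 (ha x hx).symm

/-- An abelian subgroup of `PLo` normalized by `ℤ × ℤ` is trivial if no nontrivial element of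
`ℤ × ℤ` centralizes a nontrivial element of it. Commutators with suitable elements `k` of `ℤ × ℤ`
make a nontrivial element `a` of the subgroup the identity on ever more of the interval: any `k`
does it on the common fixed points of `ℤ × ℤ`, and a `k` with slope `1` at a common fixed point `u`
does it from `u` up to the next one. Only finitely many `u` have to be treated. -/
theorem eq_bot_of_conj_ne {A : Subgroup PLo} (τ : Multiplicative (ℤ × ℤ) →* PLo)
    (hcomm : ∀ a ∈ A, ∀ b ∈ A, Commute a b)
    (hnorm : ∀ a ∈ A, ∀ t, τ t * a * (τ t)⁻¹ ∈ A)
    (hfree : ∀ a ∈ A, a ≠ 1 → ∀ k, k ≠ 1 → τ k * a * (τ k)⁻¹ ≠ a) : A = ⊥ := by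
  by_contra hA
  obtain ⟨⟨a₀, ha₀⟩, ha₀1⟩ := Subgroup.ne_bot_iff_exists_ne_one.1 hA
  replace ha₀1 : a₀ ≠ 1 := fun e => ha₀1 (Subtype.ext e)
  have hbr : ∀ a ∈ A, a ≠ 1 → ∀ k, k ≠ 1 →
      a⁻¹ * (τ k * a * (τ k)⁻¹) ∈ A ∧ a⁻¹ * (τ k * a * (τ k)⁻¹) ≠ 1 := fun a ha ha1 k hk =>
    ⟨A.mul_mem (A.inv_mem ha) (hnorm a ha k), fun h => hfree a ha ha1 k hk
      (inv_mul_eq_one.1 h).symm⟩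
  set X : Set unitInterval := {x | ∀ t, (τ t).1 x = x} with hX
  have hXinv : ∀ t, ∀ x ∈ X, ((τ t)⁻¹).1 x = x := fun t x hx =>
    (inv_apply_eq_iff _).2 (hx t).symm
  -- For `u ∈ X`, the points to the right of `u` up to the next point of `X`.
  let J : unitInterval → Set unitInterval := fun u => {x | u < x ∧ ∀ y ∈ X, u < y → x < y}
  have hJ : ∀ u ∈ X, ∀ g : PLo, (∀ y ∈ X, g.1 y = y) → ∀ x ∈ J u, g.1 x ∈ J u := by
    intro u hu g hg x hx
    refine ⟨?_, fun y hy huy => ?_⟩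
    · simpa [hg u hu] using strictMono_coe g hx.1
    · simpa [hg y hy] using strictMono_coe g (hx.2 y hy huy)
  have step : ∀ F : Finset unitInterval, ∃ a ∈ A, a ≠ 1 ∧ (∀ x ∈ X, a.1 x = x) ∧
      ∀ u ∈ F, u ∈ X → ∀ x ∈ J u, a.1 x = x := by
    intro F
    induction F using Finset.induction_on with
    | empty =>
      have hk : Multiplicative.ofAdd ((1, 0) : ℤ × ℤ) ≠ 1 := by decide
      obtain ⟨h1, h2⟩ := hbr a₀ ha₀ ha₀1 _ hk
      refine ⟨_, h1, h2, fun x hx => ?_, by simp⟩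
      rw [mul_apply, conj_apply_eq_of_fixed (hcomm _ ha₀ _ (hnorm _ ha₀ _)) (hx _),
        inv_apply_self]
    | insert u F _ ih =>
      obtain ⟨a, ha, ha1, haX, haF⟩ := ih
      by_cases hu : u ∈ X ∧ u < 1
      · obtain ⟨k, hk1, hk⟩ := exists_ne_one_hasSlope_one τ hu.2 hu.1
        have hkJ : ∀ x ∈ J u, (τ k).1 x = x := fun x hx =>
          apply_eq_of_eventually_right (S := range τ)
            (by
              rintro _ ⟨t, rfl⟩
              exact (Commute.all k t).map τ)
            hx.1 hk.eventually_eq fun y h1 h2 => by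
              by_contra! hcon
              exact (hx.2 y (fun t => hcon _ ⟨t, rfl⟩) h1).not_ge h2
        obtain ⟨h1, h2⟩ := hbr a ha ha1 k hk1
        refine ⟨_, h1, h2, fun x hx => ?_, fun u' hu' hu'X x hx => ?_⟩
        · exact inv_mul_conj_apply_eq haX (fun x hx => by rwa [hXinv k x hx]) hx
        · rcases Finset.mem_insert.1 hu' with rfl | hu'F
          · rw [mul_apply, mul_apply, mul_apply, (inv_apply_eq_iff _).2 (hkJ x hx).symm,
              hkJ _ (hJ u' hu'X a haX x hx), inv_apply_self]
          · exact inv_mul_conj_apply_eq (haF u' hu'F hu'X) (hJ u' hu'X _ (hXinv k)) hx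
      · refine ⟨a, ha, ha1, haX, fun u' hu' hu'X x hx => ?_⟩
        rcases Finset.mem_insert.1 hu' with rfl | hu'F
        · exact absurd ⟨hu'X, hx.1.trans_le unitInterval.le_one'⟩ hu
        · exact haF u' hu'F hu'X x hx
  -- A common fixed point of two generators is in `X`.
  set s := Multiplicative.ofAdd ((1, 0) : ℤ × ℤ)
  set t := Multiplicative.ofAdd ((0, 1) : ℤ × ℤ)
  have hgen : ∀ y, (τ s).1 y = y → (τ t).1 y = y → y ∈ X := by
    intro y hs ht k
    let H : Subgroup (Multiplicative (ℤ × ℤ)) :=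
      { carrier := {k | (τ k).1 y = y}
        one_mem' := by
          rw [mem_ofPred_eq, map_one]
          rfl
        mul_mem' := fun {a b} (ha : (τ a).1 y = y) (hb : (τ b).1 y = y) => by
          rw [mem_ofPred_eq, map_mul, mul_apply, hb, ha]
        inv_mem' := fun {a} (ha : (τ a).1 y = y) => by
          rw [mem_ofPred_eq, map_inv]
          exact (inv_apply_eq_iff _).2 ha.symm }
    have hk : k = s ^ k.toAdd.1 * t ^ k.toAdd.2 := by
      rw [← ofAdd_zsmul, ← ofAdd_zsmul, ← ofAdd_add]
      simp
    have : k ∈ H := by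
      rw [hk]
      exact H.mul_mem (H.zpow_mem hs _) (H.zpow_mem ht _)
    exact this
  obtain ⟨a, -, ha1, haX, haF⟩ := step ((finite_boundaryFixedPoints (τ s)).union
    (finite_boundaryFixedPoints (τ t))).toFinset
  refine ha1 (PLo.ext fun x => ?_)
  by_cases hx : x ∈ X
  · exact haX x hx
  have hcl : IsClosed X := by
    rw [hX, ofPred_forall]
    exact isClosed_iInter fun t => isClosed_eq (τ t).1.continuous continuous_id
  obtain ⟨u, hu, hum⟩ := (hcl.inter isClosed_Iic).isCompact.exists_isGreatest
    (s := X ∩ Iic x) ⟨0, fun t => apply_zero _, unitInterval.nonneg'⟩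
  have hux : u < x := lt_of_le_of_ne hu.2 fun e => hx (e ▸ hu.1)
  refine haF u ?_ hu.1 x ⟨hux, fun y hy huy => not_le.1 fun hyx => huy.not_ge (hum ⟨hy, hyx⟩)⟩
  rw [Finite.mem_toFinset]
  -- Otherwise both generators are the identity near `u`, so `X` contains points just right of `u`.
  by_contra hcon
  rw [mem_union, not_or] at hcon
  have h1 : ∀ᶠ y in 𝓝 u, (τ s).1 y = y := not_not.1 fun h => hcon.1 ⟨hu.1 s, h⟩
  have h2 : ∀ᶠ y in 𝓝 u, (τ t).1 y = y := not_not.1 fun h => hcon.2 ⟨hu.1 t, h⟩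
  have := nhdsGT_neBot_of_exists_gt ⟨x, hux⟩
  obtain ⟨y, ⟨hy1, hy2⟩, hyI⟩ :=
    (((h1.and h2).filter_mono nhdsWithin_le_nhds).and (Ioo_mem_nhdsGT hux)).exists
  exact hyI.1.not_ge (hum ⟨hgen y hy1 hy2, hyI.2.le⟩)

end PLo

/-! ### The wreath product -/

namespace RestrictedWreathProduct

variable {C T : Type*} [Group C] [Group T]

/-- The inclusion of the acting group in the restricted wreath product. -/
def inl : T →* RestrictedWreathProduct C T :=
  RegularWreathProduct.inl.codRestrict _ fun t => by
    simp [RestrictedWreathProduct]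

theorem coe_inl (t : T) :
    ((inl t : RestrictedWreathProduct C T) : RegularWreathProduct C T) =
      RegularWreathProduct.inl t := rfl

/-- The base group of the restricted wreath product: the pairs with trivial second component. -/
def base : Subgroup (RestrictedWreathProduct C T) :=
  (RegularWreathProduct.rightHom.comp (RestrictedWreathProduct C T).subtype).ker

theorem mem_base {a : RestrictedWreathProduct C T} : a ∈ base ↔ a.1.right = 1 := Iff.rfl

theorem commute_of_mem_base {C T : Type*} [CommGroup C] [Group T]
    {a b : RestrictedWreathProduct C T} (ha : a ∈ base) (hb : b ∈ base) : Commute a b := by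
  rw [mem_base] at ha hb
  refine Subtype.ext (RegularWreathProduct.ext ?_ ?_)
  · funext x
    simp [ha, hb, mul_comm]
  · simp [ha, hb]

/-- The support of a base element is finite, so it is not invariant under translation by an element
of infinite order. -/
theorem conj_ne_of_mem_base [IsMulTorsionFree T] {a : RestrictedWreathProduct C T} (ha : a ∈ base)
    (ha1 : a ≠ 1) {k : T} (hk : k ≠ 1) : inl k * a * (inl k)⁻¹ ≠ a := by
  intro h
  rw [mul_inv_eq_iff_eq_mul] at h
  rw [mem_base] at ha
  have hinv : ∀ x, a.1.left (k⁻¹ * x) = a.1.left x := fun x => by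
    have := congrFun (congrArg (fun w : RestrictedWreathProduct C T => w.1.left) h) x
    simpa [coe_inl, ha] using this
  obtain ⟨x, hx⟩ : ∃ x, a.1.left x ≠ 1 := by
    by_contra! hcon
    exact ha1 (Subtype.ext (RegularWreathProduct.ext (funext hcon) ha))
  have hpow : ∀ n : ℕ, a.1.left (k⁻¹ ^ n * x) = a.1.left x := by
    intro n
    induction n with
    | zero => simp
    | succ n ih => rw [pow_succ', mul_assoc, hinv, ih]
  have hinj : Function.Injective fun n : ℕ => k⁻¹ ^ n * x := fun m n hmn =>
    injective_pow_iff_not_isOfFinOrder.2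
      (not_isOfFinOrder_of_isMulTorsionFree (inv_ne_one.2 hk)) (mul_right_cancel hmn)
  refine infinite_range_of_injective hinj (a.2.subset ?_)
  rintro _ ⟨n, rfl⟩
  rw [Function.mem_mulSupport, hpow]
  exact hx

end RestrictedWreathProduct

theorem lemma4p2 :
    ¬ ∃ φ : RestrictedWreathProduct (Multiplicative ℤ) (Multiplicative (ℤ × ℤ)) →* PLo,
      Function.Injective φ := by
  rintro ⟨φ, hφ⟩
  have hbot := PLo.eq_bot_of_conj_ne (A := RestrictedWreathProduct.base.map φ)
    (φ.comp RestrictedWreathProduct.inl) ?_ ?_ ?_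
  · rw [Subgroup.map_eq_bot_iff_of_injective _ hφ] at hbot
    let a : RestrictedWreathProduct (Multiplicative ℤ) (Multiplicative (ℤ × ℤ)) :=
      ⟨⟨Pi.mulSingle 1 (Multiplicative.ofAdd 1), 1⟩,
        (finite_singleton 1).subset Pi.mulSupport_mulSingle_subset⟩
    have ha : a ∈ (⊥ : Subgroup _) := hbot ▸ RestrictedWreathProduct.mem_base.2 rfl
    have h := congrFun (congrArg (fun w : RestrictedWreathProduct (Multiplicative ℤ)
      (Multiplicative (ℤ × ℤ)) => w.1.left) (Subgroup.mem_bot.1 ha)) 1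
    simp [a] at h
  · rintro _ ⟨a, ha, rfl⟩ _ ⟨b, hb, rfl⟩
    exact (RestrictedWreathProduct.commute_of_mem_base ha hb).map φ
  · rintro _ ⟨a, ha, rfl⟩ t
    refine ⟨RestrictedWreathProduct.inl t * a * (RestrictedWreathProduct.inl t)⁻¹,
      MonoidHom.normal_ker _ |>.conj_mem a ha _, by simp⟩
  · rintro _ ⟨a, ha, rfl⟩ ha1 k hk h
    refine RestrictedWreathProduct.conj_ne_of_mem_base ha (fun e => ha1 (by rw [e, map_one])) hk
      (hφ ?_)
    simpa using h
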